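/- For a family $H_1,\dots,H_m$ of graphs on a common vertex set $V$, a rainbow perfect matching is a perfect matching $M$ of the complete graph on $V$ together with a bijection $\varphi$ from $\{1,\dots,m\}$ onto the edge set of $M$ such that $\varphi(i)$ is an edge of $H_i$ for every $i$. Let $G(n,p)$ denote the binomial random graph on $[n]=\{1,\dots,n\}$, in which each of the $\binom n2$ pairs is an edge independently with probability $p$, and let $\delta(H)$ denote the minimum degree of a graph $H$. Theorem. Let $\varepsilon>0$ be fixed and let $p=p(n)\in[0,1]$ satisfy $p=\omega\left(\frac{\log n}{n}\right)$, i.e. $\frac{\log n}{n\,p(n)}\to 0$ as $n\to\infty$ through the even integers. For every even $n$ let $G_1,\dots,G_{n/2}$ be independent samples of $G(n,p)$ on the same vertex set $[n]$. Then the probability of the following event tends to $1$ as $n\to\infty$ through the even integers: for every choice of spanning subgraphs $H_i\subseteq G_i$, $1\le i\le n/2$, with $\delta(H_i)\ge\left(\frac12+\varepsilon\right)np$ for every $i$, the family $H_1,\dots,H_{n/2}$ admits a rainbow perfect matching. -/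

import Mathlib

open Filter Asymptotics MeasureTheory
open scoped Topology

/-- A family `H` of simple graphs on a common vertex set `V` admits a *rainbow perfect matching*:
there is a perfect matching `M` of the complete graph on `V` and a bijection between the index set
of the family and the edges of `M` such that the edge assigned to `i` is an edge of `H i`.
In other words, `M` consists of exactly one edge from each member of the family. -/
def HasRainbowPerfectMatching {V ι : Type*} (H : ι → SimpleGraph V) : Prop :=
  ∃ M : (⊤ : SimpleGraph V).Subgraph, M.IsPerfectMatching ∧
    ∃ φ : ι ≃ M.edgeSet, ∀ i, (φ i : Sym2 V) ∈ (H i).edgeSet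

open scoped Classical in
/-- The event that a family `G` of graphs on a finite vertex set `V` has the property that
every family of spanning subgraphs `H i ⊆ G i`, each of minimum degree at least `d`, admits a
rainbow perfect matching. -/
def rainbowMatchingResilient (V ι : Type*) [Fintype V] (d : ℝ) : Set (ι → SimpleGraph V) :=
  {G | ∀ H : ι → SimpleGraph V, (∀ i, H i ≤ G i) → (∀ i, d ≤ ((H i).minDegree : ℝ)) →
    HasRainbowPerfectMatching H}

/-! Write `n = 2m`. A permutation `π` of the vertices gives `H i` the vertex `π i` for `i < m` and
leaves the last `m` positions free. Joining `i` to a free position `k` when `π i` and `π k` are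
adjacent in `H i` defines a bipartite graph, and a perfect matching of it is a rainbow perfect
matching. Two facts produce one through Hall's theorem.

Degrees: for a uniformly random `π`, all bipartite degrees are at least `D = (1/2 + ε/2)mp` with
positive probability (`exists_perm_card_adj`). This is deterministic in the `H i`, so it holds for
every choice of subgraphs.

Sparsity: with high probability, for every choice of vertices for `s` of the graphs and every vertex
set of size `t` with `min s t ≤ m/2`, not both empty, the `G i` have fewer than `D * max s t` edges
between them (`measureReal_exists_threshold_le_edgeCount`). The mean is at most `p * max s t * m/2`,
and `np ≫ log n` pays for the union bound over about `n^(s+t)` choices. The event concerns only the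
`G i`, so it survives any choice of `H i` and `π`.

A violation of Hall's condition would create such a pair carrying at least `D * max s t` edges
(`hasRainbowPerfectMatching_of_perm`). -/

/-! ### Sparsity of the random graphs: Chernoff bound and union bound. -/

section
open scoped Classical
open SimpleGraph ProbabilityTheory unitInterval Finset

variable {V ι : Type*} [Fintype V] [Fintype ι]

/-- The number of edges that the graphs `G i` have between the vertex `x i` (if there is one)
and the set `T`. -/
noncomputable def edgeCount (G : ι → SimpleGraph V) (x : ι → Option V) (T : Finset V) : ℕ :=
  ∑ i, (x i).elim 0 fun v => #{y ∈ T | (G i).Adj v y}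

/-- There are finitely many graphs on `V`, so this makes all events and functions of them
measurable. -/
lemma measurableSingletonClass_simpleGraph : MeasurableSingletonClass (SimpleGraph V) where
  measurableSet_singleton G :=
    ⟨{G.Adj}, .singleton _, by ext H; exact SimpleGraph.ext_iff.symm⟩

attribute [local instance] measurableSingletonClass_simpleGraph

lemma integral_prod_edgeSet_binomialRandom (p : I) (f : Sym2 V → Prop → ℝ) :
    ∫ G, ∏ e, f e (e ∈ G.edgeSet) ∂(binomialRandom V p) =
      ∏ e, (p * f e (¬ e.IsDiag) + (1 - p) * f e False) := by
  rw [binomialRandom_eq_map,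
    integral_map (by fun_prop) Measurable.of_discrete.aestronglyMeasurable]
  have : ∀ᵐ s ∂setBernoulli (Sym2.diagSet : Set (Sym2 V))ᶜ p,
      ∏ e, f e (e ∈ (fromEdgeSet s : SimpleGraph V).edgeSet) = ∏ e, f e (e ∈ s) := by
    filter_upwards [setBernoulli_ae_subset] with s hs
    refine prod_congr rfl fun e _ => ?_
    congr 1
    have := @hs e
    simp at this ⊢
    exact this
  rw [integral_congr_ae this, setBernoulli_eq_map,
    integral_map (by fun_prop) Measurable.of_discrete.aestronglyMeasurable,
    Measure.infinitePi_eq_pi]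
  simp only [Set.mem_ofPred_eq]
  rw [integral_fintype_prod_eq_prod (𝕜 := ℝ)]
  refine prod_congr rfl fun e _ => ?_
  rw [integral_add_measure .of_finite .of_finite]
  simp [integral_smul_nnreal_measure, NNReal.smul_def]

lemma integral_exp_card_adj_le (p : I) {θ : ℝ} (hθ : 0 ≤ θ) (v : V) (T : Finset V) :
    ∫ G, Real.exp (θ * #{y ∈ T | G.Adj v y}) ∂(binomialRandom V p) ≤
      Real.exp ((Real.exp θ - 1) * p * #T) := by
  have hinj : Set.InjOn (fun y => s(v, y)) (T : Set V) := fun a _ b _ h => by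
    exact Sym2.congr_right.1 h
  obtain ⟨f, hf⟩ : ∃ f : Sym2 V → Prop → ℝ, ∀ e a, f e a =
      if e ∈ T.image (fun y => s(v, y)) then (if a then Real.exp θ else 1) else 1 :=
    ⟨_, fun _ _ => rfl⟩
  have h1 : ∀ G : SimpleGraph V, Real.exp (θ * #{y ∈ T | G.Adj v y}) =
      ∏ e, f e (e ∈ G.edgeSet) := by
    intro G
    simp only [hf]
    rw [prod_ite_mem, univ_inter, prod_image hinj]
    simp only [mem_edgeSet]
    rw [prod_ite, prod_const, prod_const_one, mul_one, ← Real.exp_nat_mul, mul_comm]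
  simp_rw [h1]
  rw [integral_prod_edgeSet_binomialRandom p f]
  simp only [hf]
  have hp := p.2.1
  have h0 : 0 ≤ (Real.exp θ - 1) * p :=
    mul_nonneg (by linarith [Real.one_le_exp hθ]) hp
  calc _ ≤ ∏ e, if e ∈ T.image (fun y => s(v, y)) then Real.exp ((Real.exp θ - 1) * p) else 1 := by
        refine prod_le_prod (fun e _ => ?_) (fun e _ => ?_)
        · have := p.2.2
          have := sub_nonneg.2 this
          positivity
        · by_cases he : e ∈ T.image (fun y => s(v, y))
          -- `T` may contain `v`; the loop is never an edge and contributes the factor 1.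
          · by_cases hd : e.IsDiag
            · simp only [he, hd]
              simpa using h0
            · simp only [he, hd]
              simp
              linarith [Real.add_one_le_exp ((Real.exp θ - 1) * p)]
          · simp [he]
    _ = _ := by
        rw [prod_ite_mem, univ_inter, prod_const, ← Real.exp_nat_mul,
          card_image_of_injOn hinj]
        ring_nf

lemma integral_exp_edgeCount_le (p : I) {θ : ℝ} (hθ : 0 ≤ θ) (x : ι → Option V) (T : Finset V) :
    ∫ G, Real.exp (θ * edgeCount G x T) ∂(Measure.pi fun _ : ι => binomialRandom V p) ≤
      Real.exp ((Real.exp θ - 1) * p * (#{i | (x i).isSome} * #T)) := by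
  have h1 : ∀ G : ι → SimpleGraph V, Real.exp (θ * edgeCount G x T) =
      ∏ i, Real.exp (θ * ((x i).elim 0 fun v => #{y ∈ T | (G i).Adj v y} : ℕ)) := by
    intro G
    rw [← Real.exp_sum, edgeCount, Nat.cast_sum, mul_sum]
  simp_rw [h1]
  rw [integral_fintype_prod_eq_prod (𝕜 := ℝ) (fun i (G : SimpleGraph V) =>
    Real.exp (θ * ((x i).elim 0 fun v => #{y ∈ T | G.Adj v y} : ℕ)))]
  calc _ ≤ ∏ i, if (x i).isSome then Real.exp ((Real.exp θ - 1) * p * #T) else 1 := by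
        refine prod_le_prod (fun i _ => integral_nonneg fun _ => (Real.exp_pos _).le)
          (fun i _ => ?_)
        cases h : x i with
        | none => simp
        | some v => simpa using integral_exp_card_adj_le p hθ v T
    _ = _ := by
        rw [prod_ite, prod_const, prod_const_one, mul_one, ← Real.exp_nat_mul]
        ring_nf

lemma measureReal_le_edgeCount (p : I) {θ : ℝ} (hθ : 0 ≤ θ) (x : ι → Option V) (T : Finset V)
    (a : ℝ) :
    (Measure.pi fun _ : ι => binomialRandom V p).real {G | a ≤ edgeCount G x T} ≤
      Real.exp ((Real.exp θ - 1) * p * (#{i | (x i).isSome} * #T) - θ * a) := by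
  have h := mul_meas_ge_le_integral_of_nonneg (μ := Measure.pi fun _ : ι => binomialRandom V p)
    (f := fun G => Real.exp (θ * edgeCount G x T)) (.of_forall fun _ => (Real.exp_pos _).le)
    .of_finite (Real.exp (θ * a))
  rw [Real.exp_sub, le_div_iff₀' (Real.exp_pos _)]
  refine le_trans ?_ (integral_exp_edgeCount_le p hθ x T)
  refine (mul_le_mul_of_nonneg_left (measureReal_mono (h₂ := by exact measure_ne_top _ _)
    fun G hG => ?_) (Real.exp_pos _).le).trans h
  exact Real.exp_le_exp.2 (mul_le_mul_of_nonneg_left hG hθ)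

/-- With `θ = ε/2` the Chernoff exponent is at most `-(ε²/8) * p * m * max s t`, which beats `3 (s +
t) log n` since `s + t ≤ 2 * max s t`. -/
lemma measureReal_threshold_le_edgeCount {ε : ℝ} (hε : 0 < ε) (hε1 : ε ≤ 1) (p : I) {n m : ℕ}
    (hn : n = 2 * m) (hp : 6 * Real.log n ≤ ε ^ 2 / 1024 * (p * n)) (x : ι → Option V)
    (T : Finset V) (hmin : 2 * min #{i | (x i).isSome} #T ≤ m) :
    (Measure.pi fun _ : ι => binomialRandom V p).real
      {G | (1 / 2 + ε / 2) * m * p * (max #{i | (x i).isSome} #T : ℕ) ≤ edgeCount G x T} ≤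
      Real.exp (-(3 * Real.log n)) ^ #{i | (x i).isSome} * Real.exp (-(3 * Real.log n)) ^ #T := by
  refine (measureReal_le_edgeCount p (θ := ε / 2) (by positivity) x T _).trans ?_
  rw [← pow_add, ← Real.exp_nat_mul, Real.exp_le_exp]
  generalize #{i | (x i).isSome} = s at *
  generalize #T = t at *
  have hθ : Real.exp (ε / 2) - 1 ≤ ε / 2 + (ε / 2) ^ 2 := by
    have := Real.abs_exp_sub_one_sub_id_le (x := ε / 2) (by rw [abs_of_pos] <;> linarith)
    linarith [abs_le.1 this]
  have hst : (s * t : ℝ) = (max s t : ℕ) * (min s t : ℕ) := by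
    exact_mod_cast (max_mul_min s t).symm
  have hsum : (s + t : ℝ) ≤ 2 * (max s t : ℕ) := by
    exact_mod_cast (by omega : s + t ≤ 2 * max s t)
  have hmin' : (2 : ℝ) * (min s t : ℕ) ≤ m := by exact_mod_cast hmin
  have hM : (0 : ℝ) ≤ (max s t : ℕ) := Nat.cast_nonneg _
  have hlog : 0 ≤ Real.log n := Real.log_natCast_nonneg n
  have hp0 : (0 : ℝ) ≤ p := p.2.1
  have hnm : (n : ℝ) = 2 * m := by exact_mod_cast hn
  rw [hst]
  generalize ((max s t : ℕ) : ℝ) = M at *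
  generalize ((min s t : ℕ) : ℝ) = k at *
  have h1 : (Real.exp (ε / 2) - 1) * p * (M * k) ≤ (ε / 2 + (ε / 2) ^ 2) * p * (M * (m / 2)) := by
    have : k ≤ m / 2 := by linarith
    have h0 : 0 ≤ Real.exp (ε / 2) - 1 := by
      linarith [Real.one_le_exp (show 0 ≤ ε / 2 by positivity)]
    by_cases hk : 0 ≤ k
    · gcongr
    · have h2 : 0 ≤ (Real.exp (ε / 2) - 1) * p * M := by positivity
      have h3 : 0 ≤ (ε / 2 + (ε / 2) ^ 2) * p * (M * (m / 2)) := by positivity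
      nlinarith
  have h4 : 6 * Real.log n * M ≤ ε ^ 2 / 1024 * (p * n) * M := by gcongr
  have h5 : 3 * Real.log n * (s + t) ≤ 3 * Real.log n * (2 * M) := by gcongr
  have h6 : 0 ≤ ε ^ 2 * (p * m * M) := by positivity
  generalize Real.log n = L at *
  rw [hnm] at h4
  push_cast
  nlinarith

/-- The bounds `r^s * r^t`, with `r = n⁻³`, sum over all pairs to a product of two binomial
expansions; the `-1` removes the empty pair `o`. -/
lemma measureReal_exists_threshold_le_edgeCount {ε : ℝ} (hε : 0 < ε) (hε1 : ε ≤ 1) (p : I)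
    (m : ℕ) (hV : Fintype.card V = 2 * m) (hι : Fintype.card ι = m) (hm : 0 < m)
    (hp : 6 * Real.log (2 * m : ℕ) ≤ ε ^ 2 / 1024 * (p * (2 * m : ℕ))) :
    (Measure.pi fun _ : ι => binomialRandom V p).real
      {G | ∃ (x : ι → Option V) (T : Finset V), 0 < max #{i | (x i).isSome} #T ∧
        2 * min #{i | (x i).isSome} #T ≤ m ∧
        (1 / 2 + ε / 2) * m * p * (max #{i | (x i).isSome} #T : ℕ) ≤ edgeCount G x T} ≤
      Real.exp (1 / m) - 1 := by
  set r := Real.exp (-(3 * Real.log (2 * m : ℕ))) with hr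
  have hr' : r = 1 / (2 * m) ^ 3 := by
    rw [hr, Real.exp_neg, mul_comm, Real.exp_mul, Real.exp_log (by positivity)]
    norm_cast
    simp
  have hr0 : 0 ≤ r := (Real.exp_pos _).le
  let o : (ι → Option V) × Finset V := (fun _ => none, ∅)
  calc _ ≤ ∑ a ∈ univ.erase o, r ^ #{i | (a.1 i).isSome} * r ^ #a.2 := by
        refine (measureReal_mono (h₂ := by exact measure_ne_top _ _) ?_).trans <|
          (measureReal_biUnion_finset_le {a ∈ univ.erase o |
            2 * min #{i | (a.1 i).isSome} #a.2 ≤ m} fun a => {G : ι → SimpleGraph V |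
              (1 / 2 + ε / 2) * m * p * (max #{i | (a.1 i).isSome} #a.2 : ℕ) ≤
                edgeCount G a.1 a.2}).trans ?_
        · rintro G ⟨x, T, h0, h1, h2⟩
          simp only [Set.mem_iUnion]
          refine ⟨(x, T), ?_, h2⟩
          simp only [mem_filter, mem_erase, mem_univ, and_true]
          refine ⟨?_, h1⟩
          intro h
          obtain ⟨rfl, rfl⟩ := Prod.mk.inj h
          simp at h0
        · refine (sum_le_sum fun a ha => ?_).trans
            (sum_le_sum_of_subset_of_nonneg (filter_subset _ _) fun _ _ _ => by positivity)
          exact measureReal_threshold_le_edgeCount hε hε1 p rfl hp a.1 a.2 (mem_filter.1 ha).2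
    _ = (∑ x : ι → Option V, r ^ #{i | (x i).isSome}) * (∑ T : Finset V, r ^ #T) - 1 := by
        rw [sum_mul_sum, ← sum_product', univ_product_univ, ← sum_erase_add _ _ (mem_univ o)]
        simp [o]
    _ = (2 * m * r + 1) ^ m * (r + 1) ^ (2 * m) - 1 := by
        congr 2
        · have : ∀ x : ι → Option V, r ^ #{i | (x i).isSome} = ∏ i, (x i).elim 1 fun _ => r := by
            intro x
            rw [← prod_const, prod_filter]
            refine prod_congr rfl fun i _ => ?_
            cases x i <;> simp
          simp_rw [this]
          rw [← Fintype.prod_sum (fun (_ : ι) (y : Option V) => y.elim 1 fun _ => r)]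
          simp [Fintype.sum_option, hι, hV, add_comm]
        · have := Fintype.sum_pow_mul_eq_add_pow V r 1
          simpa [hV] using this
    _ ≤ Real.exp (1 / m) - 1 := by
        have h1 : (2 * m * r + 1) ^ m ≤ Real.exp (2 * m * r) ^ m := by
          gcongr
          exact Real.add_one_le_exp _
        have h2 : (r + 1) ^ (2 * m) ≤ Real.exp r ^ (2 * m) := by
          gcongr
          exact Real.add_one_le_exp _
        have h3 : Real.exp (2 * m * r) ^ m * Real.exp r ^ (2 * m) ≤ Real.exp (1 / m) := by
          rw [← Real.exp_nat_mul, ← Real.exp_nat_mul, ← Real.exp_add, Real.exp_le_exp, hr']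
          have : (1 : ℝ) ≤ m := by exact_mod_cast hm
          push_cast
          field_simp
          nlinarith
        have h4 := mul_le_mul h1 h2 (by positivity) (by positivity)
        linarith
end

/-! ### Uniformly random permutations: sequential exposure and upper tails. -/

section
open scoped Classical
open Finset Equiv

variable {α : Type*} [Fintype α] [DecidableEq α]

/-- Under a uniformly random permutation `π` of `α`, given the values of `π` on `S`, the value at
a further point is uniformly distributed over the remaining ones. -/
lemma card_compl_mul_sum_perm (S : Finset α) {F : Perm α → ℝ}
    (hF : ∀ π k l, k ∉ S → l ∉ S → F (π * swap k l) = F π) {k₀ : α} (hk₀ : k₀ ∉ S) (f : α → ℝ) :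
    (#Sᶜ : ℝ) * ∑ π : Perm α, F π * f (π k₀) = ∑ π : Perm α, F π * ∑ k ∈ Sᶜ, f (π k) := by
  simp_rw [mul_sum (s := Sᶜ)]
  rw [sum_comm, ← nsmul_eq_mul, ← sum_const]
  refine sum_congr rfl fun k hk => ?_
  -- Precomposing with the swap exchanges the values at `k₀` and `k`, and `F` does not notice.
  refine Fintype.sum_equiv (Equiv.mulRight (swap k₀ k)) _ _ fun π => ?_
  rw [mem_compl] at hk
  simp [hF π k₀ k hk₀ hk]

/-- Once `S` has been sent into `A`, a further point lands in `A` with probability `(#A - #S) /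
(card α - #S) ≤ #A / card α`. -/
lemma card_perm_mapsTo_le (A S : Finset α) :
    (#{π : Perm α | ∀ k ∈ S, π k ∈ A} : ℝ) ≤
      (Fintype.card α).factorial * ((#A : ℝ) / Fintype.card α) ^ #S := by
  induction S using Finset.induction_on with
  | empty => simp [Fintype.card_perm]
  | insert k₀ S hk₀ ih =>
    have h := card_compl_mul_sum_perm S
      (F := fun π => if ∀ k ∈ S, π k ∈ A then 1 else 0) (k₀ := k₀) ?_ hk₀
      (fun v => if v ∈ A then 1 else 0)
    swap
    · intro π k l hk hl
      congr 1
      refine propext (forall₂_congr fun a ha => ?_)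
      rw [Perm.mul_apply, swap_apply_of_ne_of_ne] <;> rintro rfl <;> contradiction
    have h1 : ∀ π : Perm α, ((if ∀ k ∈ S, π k ∈ A then 1 else 0) * if π k₀ ∈ A then 1 else 0 : ℝ)
        = if ∀ k ∈ insert k₀ S, π k ∈ A then 1 else 0 := by
      intro π
      simp only [mem_insert, forall_eq_or_imp, ite_and]
      split_ifs <;> simp
    have h2 : ∀ π : Perm α, ((if ∀ k ∈ S, π k ∈ A then 1 else 0) *
        ∑ k ∈ Sᶜ, if π k ∈ A then 1 else 0 : ℝ) =
        (#A - #S) * if ∀ k ∈ S, π k ∈ A then 1 else 0 := by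
      intro π
      split_ifs with hπ
      · have h3 : ∑ k, (if π k ∈ A then 1 else 0 : ℝ) = #A := by
          rw [Equiv.sum_comp π fun v => if v ∈ A then (1 : ℝ) else 0]
          simp
        rw [← sum_add_sum_compl S] at h3
        have h4 : ∑ k ∈ S, (if π k ∈ A then 1 else 0 : ℝ) = #S := by
          rw [sum_congr rfl fun k hk => if_pos (hπ k hk)]
          simp
        linarith
      · simp
    simp_rw [h1, h2, ← mul_sum, sum_boole] at h
    have hSlt : #S < Fintype.card α := card_lt_univ_of_notMem hk₀
    have hA : (#A : ℝ) ≤ Fintype.card α := by exact_mod_cast card_le_univ A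
    rw [card_compl, Nat.cast_sub hSlt.le] at h
    have hS' : (#S : ℝ) < Fintype.card α := by exact_mod_cast hSlt
    have h0 : (0 : ℝ) ≤ #S := Nat.cast_nonneg _
    have hx : (0 : ℝ) ≤ #{π : Perm α | ∀ k ∈ S, π k ∈ A} := Nat.cast_nonneg _
    generalize (#{π : Perm α | ∀ k ∈ S, π k ∈ A} : ℝ) = x at *
    rw [card_insert_of_notMem hk₀, pow_succ, ← mul_assoc]
    refine le_trans ?_ (mul_le_mul_of_nonneg_right ih (by positivity))
    rw [← mul_div_assoc, le_div_iff₀ (by linarith)]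
    refine le_of_mul_le_mul_left ?_ (sub_pos.2 hS')
    rw [← mul_assoc, h]
    have : (0 : ℝ) ≤ x * #S * (Fintype.card α - #A) :=
      mul_nonneg (mul_nonneg hx h0) (by linarith)
    nlinarith

/-- Upper bound for the moment generating function of a hypergeometric random variable. -/
lemma sum_perm_pow_card_le (A S : Finset α) {η : ℝ} (hη : 0 ≤ η) :
    ∑ π : Perm α, (1 + η) ^ #{k ∈ S | π k ∈ A} ≤
      (Fintype.card α).factorial * Real.exp (η * #A * #S / Fintype.card α) := by
  have h1 : ∀ π : Perm α, (1 + η) ^ #{k ∈ S | π k ∈ A} =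
      ∑ U ∈ S.powerset, η ^ #U * if ∀ k ∈ U, π k ∈ A then 1 else 0 := by
    intro π
    rw [← prod_const, prod_filter]
    have : ∀ k, (if π k ∈ A then 1 + η else 1) = 1 + η * if π k ∈ A then 1 else 0 := by
      intro k; split_ifs <;> simp
    simp_rw [this]
    rw [prod_one_add]
    refine sum_congr rfl fun U _ => ?_
    rw [prod_mul_distrib, prod_const, prod_boole]
    congr
  simp_rw [h1]
  rw [sum_comm]
  simp_rw [← mul_sum, sum_boole]
  calc _ ≤ ∑ U ∈ S.powerset, η ^ #U *
        ((Fintype.card α).factorial * ((#A : ℝ) / Fintype.card α) ^ #U) := by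
        gcongr with U _
        exact card_perm_mapsTo_le A U
    _ = (Fintype.card α).factorial * (η * (#A / Fintype.card α) + 1) ^ #S := by
        rw [← sum_pow_mul_eq_add_pow, mul_sum]
        refine sum_congr rfl fun U _ => ?_
        rw [one_pow, mul_pow]; ring
    _ ≤ (Fintype.card α).factorial * Real.exp (η * (#A / Fintype.card α)) ^ #S := by
        gcongr
        exact Real.add_one_le_exp _
    _ = _ := by
        rw [← Real.exp_nat_mul]
        ring_nf

end

/-! ### Lower tails for random permutations. -/

section
open scoped Classical
open Finset Equiv

variable {n : ℕ}

/-- Lower tail bound for the number of elements of `A` that a random permutation puts on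
the positions from `j` on. -/
lemma card_perm_card_Ici_lt_le (A : Finset (Fin n)) {β δ : ℝ} (hA : β * n ≤ #A) (hδ : 0 ≤ δ)
    (hδ1 : δ ≤ 1) (j : Fin n) (hj : 2 * (j : ℕ) ≤ n) :
    (#{π : Perm (Fin n) | (#{k ∈ Ici j | π k ∈ A} : ℝ) < (1 - δ) * β * (n - j)} : ℝ) ≤
      n.factorial * Real.exp (-(β * n * δ ^ 2 / 8)) := by
  have hn : (0 : ℝ) < n := by exact_mod_cast j.pos
  have h2j : (2 : ℝ) * (j : ℕ) ≤ n := by exact_mod_cast hj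
  have hjn : ((j : ℕ) : ℝ) / n ≤ 1 / 2 := by rw [div_le_iff₀ hn]; linarith
  have hj0 : 0 ≤ ((j : ℕ) : ℝ) / n := by positivity
  -- Too few elements of `A` from `j` on means too many before `j`. As `j ≤ n/2`, the excess over
  -- the mean is at least `δ * #A / 2`, so an upper tail bound suffices.
  set a : ℝ := #A * ((j : ℕ) / n) + δ * #A / 2 with ha
  have hsplit : ∀ π : Perm (Fin n),
      (#{k ∈ Iio j | π k ∈ A} : ℝ) + #{k ∈ Ici j | π k ∈ A} = #A := by
    intro π
    have h1 : #A = #{k | π k ∈ A} := (card_equiv π (by simp)).symm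
    rw [h1, ← card_filter_add_card_filter_not (s := {k | π k ∈ A}) (· < j)]
    push_cast
    congr 3 <;> ext k <;> simp [and_comm]
  have hbad : ∀ π : Perm (Fin n), (#{k ∈ Ici j | π k ∈ A} : ℝ) < (1 - δ) * β * (n - j) →
      a ≤ #{k ∈ Iio j | π k ∈ A} := by
    intro π hπ
    have h1 : β ≤ #A / n := by rwa [le_div_iff₀ hn]
    have h2 : (1 - δ) * β * (n - j) ≤ (1 - δ) * (#A / n) * (n - j) := by
      have : (0 : ℝ) ≤ n - (j : ℕ) := by linarith
      have : 0 ≤ 1 - δ := by linarith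
      gcongr
    have h3 : (1 - δ) * (#A / n) * (n - j) = (1 - δ) * (#A - #A * ((j : ℕ) / n)) := by
      field_simp
    have h4 : (#A : ℝ) * ((j : ℕ) / n) ≤ #A * (1 / 2) := by gcongr
    have := hsplit π
    nlinarith
  have hmgf := sum_perm_pow_card_le A (Iio j) (η := Real.exp (δ / 2) - 1)
    (by linarith [Real.one_le_exp (show 0 ≤ δ / 2 by positivity)])
  simp only [add_sub_cancel, ← Real.exp_nat_mul, Fintype.card_fin, Fin.card_Iio] at hmgf
  have hlow : (#{π : Perm (Fin n) | (#{k ∈ Ici j | π k ∈ A} : ℝ) < (1 - δ) * β * (n - j)} : ℝ) *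
      Real.exp (a * (δ / 2)) ≤ ∑ π : Perm (Fin n),
        Real.exp (#{k ∈ Iio j | π k ∈ A} * (δ / 2)) := by
    rw [← nsmul_eq_mul, ← sum_const]
    refine (sum_le_sum fun π hπ => ?_).trans
      (sum_le_sum_of_subset_of_nonneg (subset_univ _) fun _ _ _ => (Real.exp_pos _).le)
    have := hbad π (mem_filter.1 hπ).2
    gcongr
  have h := hlow.trans hmgf
  rw [← le_div_iff₀ (Real.exp_pos _), mul_div_assoc, ← Real.exp_sub] at h
  refine h.trans ?_
  gcongr
  have hθ : Real.exp (δ / 2) - 1 ≤ δ / 2 + (δ / 2) ^ 2 := by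
    have := Real.abs_exp_sub_one_sub_id_le (x := δ / 2) (by rw [abs_of_nonneg] <;> linarith)
    linarith [abs_le.1 this]
  have h5 : (Real.exp (δ / 2) - 1) * #A * (j : ℕ) / n ≤
      (δ / 2 + (δ / 2) ^ 2) * (#A * ((j : ℕ) / n)) := by
    rw [mul_div_assoc, mul_assoc]
    gcongr
  have h4 : (#A : ℝ) * ((j : ℕ) / n) ≤ #A * (1 / 2) := by gcongr
  have h6 : (δ / 2) ^ 2 * (#A * ((j : ℕ) / n)) ≤ (δ / 2) ^ 2 * (#A * (1 / 2)) := by gcongr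
  have h7 : β * n * δ ^ 2 ≤ #A * δ ^ 2 := by gcongr
  rw [ha]
  nlinarith

lemma card_Ici_mul_swap (A : Finset (Fin n)) (π : Perm (Fin n)) {j k l : Fin n} (hk : j ≤ k)
    (hl : j ≤ l) : #{i ∈ Ici j | (π * swap k l) i ∈ A} = #{i ∈ Ici j | π i ∈ A} := by
  refine card_equiv (swap k l) fun i => ?_
  rw [mem_filter, mem_filter, mem_Ici, mem_Ici, Perm.mul_apply]
  refine and_congr_left fun _ => ?_
  rcases eq_or_ne i k with rfl | hik
  · simp [hk, hl]
  rcases eq_or_ne i l with rfl | hil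
  · simp [hk, hl]
  rw [swap_apply_of_ne_of_ne hik hil]

/-- Expose `π` position by position. The condition at `j` depends only on which values remain, hence
on `π` before `j`; when it holds, the next factor has conditional mean at most `1 - ηq ≤ exp (-ηq)`,
and otherwise the product vanishes. -/
lemma sum_perm_prod_le (N : Fin n → Finset (Fin n)) (q : ℝ) {η : ℝ} (hη : 0 ≤ η) (hη1 : η ≤ 1)
    {m : ℕ} (hm : m ≤ n) :
    ∑ π : Perm (Fin n), ∏ j ∈ ({j : Fin n | (j : ℕ) < m} : Finset (Fin n)),
      (if q * (n - j) ≤ #{k ∈ Ici j | π k ∈ N j} then 1 - η * (if π j ∈ N j then 1 else 0) else 0)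
      ≤ n.factorial * Real.exp (-(η * q)) ^ m := by
  induction m with
  | zero => simp [Fintype.card_perm]
  | succ i ih =>
    specialize ih (by omega)
    let i' : Fin n := ⟨i, by omega⟩
    have hins : ({j : Fin n | (j : ℕ) < i + 1} : Finset (Fin n)) = insert i' (Iio i') := by
      ext j
      simp only [i', mem_filter, mem_univ, true_and, mem_insert, mem_Iio, Fin.ext_iff, Fin.lt_def]
      omega
    have hI : ({j : Fin n | (j : ℕ) < i} : Finset (Fin n)) = Iio i' := by
      ext j; simp [i', Fin.lt_def]
    rw [hI] at ih
    rw [hins]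
    simp_rw [prod_insert (show i' ∉ Iio i' by simp)]
    set F : Perm (Fin n) → ℝ := fun π => ∏ j ∈ Iio i',
      (if q * (n - (j : ℕ)) ≤ #{k ∈ Ici j | π k ∈ N j} then 1 - η * (if π j ∈ N j then 1 else 0)
        else 0) with hF
    have hF0 : ∀ π, 0 ≤ F π := by
      intro π
      refine prod_nonneg fun j _ => ?_
      split_ifs <;> linarith
    let F' : Perm (Fin n) → ℝ := fun π =>
      if q * (n - (i' : ℕ)) ≤ #{k ∈ Ici i' | π k ∈ N i'} then F π else 0
    have hF'0 : ∀ π, 0 ≤ F' π := by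
      intro π
      simp only [F']
      split_ifs
      exacts [hF0 π, le_rfl]
    have hswap : ∀ π k l, k ∉ Iio i' → l ∉ Iio i' → F' (π * swap k l) = F' π := by
      intro π k l hk hl
      simp only [mem_Iio, not_lt] at hk hl
      simp only [F', hF, card_Ici_mul_swap _ π hk hl]
      congr 1
      refine prod_congr rfl fun j hj => ?_
      rw [mem_Iio] at hj
      rw [card_Ici_mul_swap _ π (hj.le.trans hk) (hj.le.trans hl), Perm.mul_apply,
        swap_apply_of_ne_of_ne (hj.trans_le hk).ne (hj.trans_le hl).ne]
    have h := card_compl_mul_sum_perm (Iio i') hswap (k₀ := i') (by simp)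
      (fun v => 1 - η * (if v ∈ N i' then 1 else 0))
    have hcompl : (Iio i')ᶜ = Ici i' := by ext; simp
    have hni : (0 : ℝ) < n - i := by
      have : ((i + 1 : ℕ) : ℝ) ≤ n := by exact_mod_cast hm
      push_cast at this
      linarith
    have hcard : (#(Ici i') : ℝ) = n - i := by
      rw [Fin.card_Ici, Nat.cast_sub (by simp [i']; omega)]
    rw [hcompl, hcard] at h
    have hstep : ∀ π, F' π * ∑ k ∈ Ici i', (1 - η * (if π k ∈ N i' then 1 else 0)) ≤
        F π * ((n - i) * Real.exp (-(η * q))) := by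
      intro π
      by_cases hg : q * (n - (i' : ℕ)) ≤ #{k ∈ Ici i' | π k ∈ N i'}
      · simp only [F', if_pos hg]
        refine mul_le_mul_of_nonneg_left ?_ (hF0 π)
        rw [sum_sub_distrib, ← mul_sum, sum_boole, sum_const, nsmul_eq_mul, hcard, mul_one]
        have h1 : η * (q * (n - i)) ≤ η * #{k ∈ Ici i' | π k ∈ N i'} := by gcongr
        have h2 := Real.add_one_le_exp (-(η * q))
        nlinarith
      · simp only [F', if_neg hg, zero_mul]
        have := hF0 π
        positivity
    have hsum := sum_le_sum fun (π : Perm (Fin n)) (_ : π ∈ univ) => hstep π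
    rw [← h, ← sum_mul, mul_left_comm, mul_le_mul_iff_right₀ hni] at hsum
    have hrew : ∀ π : Perm (Fin n), (if q * (n - (i' : ℕ)) ≤ #{k ∈ Ici i' | π k ∈ N i'} then
        1 - η * (if π i' ∈ N i' then 1 else 0) else 0) * F π =
        F' π * (1 - η * (if π i' ∈ N i' then 1 else 0)) := by
      intro π
      simp only [F']
      split_ifs <;> ring
    rw [sum_congr rfl fun π _ => hrew π]
    refine hsum.trans ?_
    rw [pow_succ, ← mul_assoc]
    gcongr

/-- Lower tail bound for the number of `j < m` with `π j ∈ N j`, for a random permutation `π`. -/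
lemma card_perm_card_lt_le (N : Fin n → Finset (Fin n)) (q a : ℝ) {θ : ℝ} (hθ : 0 ≤ θ) {m : ℕ}
    (hm : m ≤ n) :
    (#{π : Perm (Fin n) | (∀ j : Fin n, (j : ℕ) < m → q * (n - j) ≤ #{k ∈ Ici j | π k ∈ N j}) ∧
      (#{j : Fin n | (j : ℕ) < m ∧ π j ∈ N j} : ℝ) < a} : ℝ) ≤
      n.factorial * Real.exp (θ * a - (1 - Real.exp (-θ)) * q * m) := by
  have hη1 : 1 - Real.exp (-θ) ≤ 1 := by linarith [Real.exp_pos (-θ)]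
  have hη : 0 ≤ 1 - Real.exp (-θ) := by
    linarith [Real.exp_le_one_iff.2 (show -θ ≤ 0 by linarith)]
  have h := sum_perm_prod_le N q hη hη1 hm
  rw [sub_eq_add_neg, Real.exp_add, mul_left_comm, ← div_le_iff₀' (Real.exp_pos _), div_eq_mul_inv,
    ← Real.exp_neg, ← nsmul_eq_mul, ← sum_const]
  rw [← Real.exp_nat_mul, mul_comm (m : ℝ), neg_mul] at h
  refine le_trans ?_ h
  refine (sum_le_sum fun π hπ => ?_).trans
    (sum_le_sum_of_subset_of_nonneg (subset_univ _) fun π _ _ => prod_nonneg fun j _ => ?_)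
  · obtain ⟨hgood, hlt⟩ := (mem_filter.1 hπ).2
    rw [prod_congr rfl fun j hj => if_pos (hgood j (mem_filter.1 hj).2)]
    have : ∀ j, 1 - (1 - Real.exp (-θ)) * (if π j ∈ N j then 1 else 0) =
        if π j ∈ N j then Real.exp (-θ) else 1 := by
      intro j; split_ifs <;> ring
    simp_rw [this]
    rw [prod_ite, prod_const, prod_const_one, mul_one, filter_filter, ← Real.exp_nat_mul,
      Real.exp_le_exp]
    nlinarith
  · split_ifs <;> linarith

end

/-! ### A permutation preserving all degrees. -/

section
open scoped Classical
open Finset Equiv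

/-- If all graphs `H i` have large minimum degree, then their vertex set `Fin (2 * m)` can be
permuted so that, when the graph `H i` is given the vertex in position `i`, every graph has many
edges from its vertex to the last `m` positions, and every vertex is joined to the
vertices of many graphs. -/
lemma exists_perm_card_adj {ε p : ℝ} (hε : 0 < ε) (hε1 : ε ≤ 1) (hp0 : 0 ≤ p) {n m : ℕ}
    (hn : n = 2 * m) (hm : 0 < m) (hmn : m ≤ n)
    (hp : 6 * Real.log n ≤ ε ^ 2 / 1024 * (p * n)) (H : Fin m → SimpleGraph (Fin n))
    (hH : ∀ i v, (1 / 2 + ε) * n * p ≤ #{y | (H i).Adj v y}) :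
    ∃ π : Perm (Fin n),
      (∀ i : Fin m, (1 / 2 + ε / 2) * m * p ≤
        #{k : Fin n | m ≤ (k : ℕ) ∧ (H i).Adj (π (Fin.castLE hmn i)) (π k)}) ∧
      ∀ y : Fin n, (1 / 2 + ε / 2) * m * p ≤ #{i : Fin m | (H i).Adj (π (Fin.castLE hmn i)) y} := by
  have hnm : (n : ℝ) = 2 * m := by exact_mod_cast hn
  have hm' : (1 : ℝ) ≤ m := by exact_mod_cast hm
  set δ : ℝ := ε / 8 with hδ
  set β : ℝ := (1 / 2 + ε) * p with hβ
  set a : ℝ := (1 / 2 + ε / 2) * m * p with ha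
  set L : ℝ := Real.log n with hL
  let N : Fin n → Fin n → Finset (Fin n) := fun y j =>
    if h : (j : ℕ) < m then univ.filter fun v => (H ⟨j, h⟩).Adj v y else ∅
  let A : Fin m → Fin n → Finset (Fin n) := fun i v => {y | (H i).Adj v y}
  -- The vertex ranges over all of `Fin n`, so that it may later be taken to be `π i`, which depends
  -- on `π`.
  let B₁ : Fin m × Fin n × Fin n → Finset (Perm (Fin n)) := fun t =>
    if 2 * (t.2.2 : ℕ) ≤ n then
      univ.filter fun π =>
        (#{k ∈ Ici t.2.2 | π k ∈ A t.1 t.2.1} : ℝ) < (1 - δ) * β * (n - t.2.2) else ∅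
  let B₂ : Fin n → Finset (Perm (Fin n)) := fun y =>
    {π | (∀ j : Fin n, (j : ℕ) < m →
        (1 - δ) * β * (n - j) ≤ #{k ∈ Ici j | π k ∈ N y j}) ∧
      (#{j : Fin n | (j : ℕ) < m ∧ π j ∈ N y j} : ℝ) < a}
  have hB₁ : ∀ t, (#(B₁ t) : ℝ) ≤ n.factorial * Real.exp (-(6 * L)) := by
    rintro ⟨i, v, j⟩
    simp only [B₁]
    split_ifs with hj
    · refine (card_perm_card_Ici_lt_le (A i v) (β := β) ?_ (by positivity) (by linarith) j
        hj).trans ?_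
      · refine le_trans (le_of_eq ?_) (hH i v)
        rw [hβ]; ring
      · gcongr
        have : 0 ≤ ε * (ε ^ 2 * (p * n)) := by positivity
        -- This is where the constant 1024 comes from: `β ≥ p/2` and `δ = ε/8` give `β n δ² / 8 ≥ ε²
        -- p n / 1024`.
        rw [hβ, hδ]
        nlinarith
    · simp; positivity
  have hB₂ : ∀ y, (#(B₂ y) : ℝ) ≤ n.factorial * Real.exp (-(6 * L)) := by
    intro y
    refine (card_perm_card_lt_le (N y) ((1 - δ) * β) a (θ := ε / 8) (by positivity) hmn).trans ?_
    gcongr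
    have hθ : ε / 8 - (ε / 8) ^ 2 ≤ 1 - Real.exp (-(ε / 8)) := by
      have := Real.abs_exp_sub_one_sub_id_le (x := -(ε / 8))
        (by rw [abs_neg, abs_of_pos] <;> linarith)
      rw [neg_sq] at this
      linarith [abs_le.1 this]
    have h1 : (ε / 8 - (ε / 8) ^ 2) * ((1 - δ) * β) * m ≤
        (1 - Real.exp (-(ε / 8))) * ((1 - δ) * β) * m := by
      have : 0 ≤ (1 - δ) * β := mul_nonneg (by linarith) (by positivity)
      gcongr
    -- One factor `1 - ε/8` comes from `1 - exp (-θ) ≥ θ(1 - θ)`, the other from `1 - δ`; the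
    -- surplus `ε/8` makes the exponent at most `-ε² p m / 64`.
    have h2 : (1 / 2 + ε / 2) + ε / 8 ≤ (1 - ε / 8) * ((1 - ε / 8) * (1 / 2 + ε)) := by
      nlinarith [mul_nonneg hε.le (sub_nonneg.2 hε1), mul_nonneg (mul_nonneg hε.le hε.le) hε.le]
    have h3 := mul_le_mul_of_nonneg_left h2 (show 0 ≤ ε / 8 * (p * m) by positivity)
    have h4 : 0 ≤ ε ^ 2 * (p * m) := by positivity
    rw [hnm] at hp
    rw [hβ, hδ] at h1
    rw [ha, hβ, hδ]
    nlinarith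
  have hsmall : (#(univ : Finset (Fin m × Fin n × Fin n)) + #(univ : Finset (Fin n)) : ℝ) *
      Real.exp (-(6 * L)) < 1 := by
    have hn0 : (0 : ℝ) < n := by linarith
    rw [Real.exp_neg, hL, mul_comm (6 : ℝ), Real.exp_mul, Real.exp_log hn0, ← div_eq_mul_inv,
      div_lt_one (by positivity)]
    have : (2 : ℝ) ≤ n := by linarith
    simp only [card_univ, Fintype.card_prod, Fintype.card_fin]
    have h6 : (n : ℝ) ^ (6 : ℝ) = (n : ℝ) ^ 6 := by norm_cast
    rw [h6]
    push_cast
    have h1 : (m : ℝ) * (n * n) ≤ n * (n * n) := by gcongr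
    have h2 : (n : ℝ) * 2 * 2 * 2 * 2 ≤ n * n * n * n * n := by gcongr
    have h3 : (n : ℝ) * n * n * 2 * 2 ≤ n * n * n * n * n := by gcongr
    have h4 : (n : ℝ) * n * n * n * n * 2 ≤ n * n * n * n * n * n := by gcongr
    have h5 : 0 < (n : ℝ) * n * n * n * n := by positivity
    nlinarith
  obtain ⟨π, hπ⟩ : ∃ π, π ∉ univ.biUnion B₁ ∪ univ.biUnion B₂ := by
    by_contra! hall
    have h1 : (n.factorial : ℝ) ≤ ∑ t, (#(B₁ t) : ℝ) + ∑ y, (#(B₂ y) : ℝ) := by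
      have h2 : univ ⊆ univ.biUnion B₁ ∪ univ.biUnion B₂ := fun π _ => hall π
      have h3 := (card_le_card h2).trans
        ((card_union_le _ _).trans (add_le_add card_biUnion_le card_biUnion_le))
      rw [card_univ, Fintype.card_perm, Fintype.card_fin] at h3
      exact_mod_cast h3
    have h4 := sum_le_sum fun t (_ : t ∈ univ) => hB₁ t
    have h5 := sum_le_sum fun t (_ : t ∈ univ) => hB₂ t
    rw [sum_const, nsmul_eq_mul] at h4 h5
    have h6 : (0 : ℝ) < n.factorial := by positivity
    nlinarith
  simp only [mem_union, mem_biUnion, mem_univ, true_and, not_or, not_exists] at hπ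
  obtain ⟨hπ₁, hπ₂⟩ := hπ
  -- Used twice: `j = m` gives the degrees of the graphs, and `j < m` supplies the condition inside
  -- `B₂` for the degrees of the vertices.
  have hgood : ∀ i v (j : Fin n), 2 * (j : ℕ) ≤ n →
      (1 - δ) * β * (n - j) ≤ #{k ∈ Ici j | (H i).Adj v (π k)} := by
    intro i v j hj
    simpa [B₁, hj, A] using hπ₁ (i, v, j)
  refine ⟨π, fun i => ?_, fun y => ?_⟩
  · have h := hgood i (π (Fin.castLE hmn i)) ⟨m, by omega⟩ (by simp; omega)
    refine le_trans ?_ (h.trans_eq ?_)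
    · have h2 : 1 / 2 + ε / 2 ≤ (1 - ε / 8) * (1 / 2 + ε) := by
        nlinarith [mul_nonneg hε.le (sub_nonneg.2 hε1)]
      have h3 := mul_le_mul_of_nonneg_right h2 (show 0 ≤ p * m by positivity)
      rw [ha, hβ, hδ, hnm]
      simp only
      nlinarith
    · congr 2
      ext k
      simp [Fin.le_def]
  · have h := hπ₂ y
    simp only [B₂, mem_filter, mem_univ, true_and, not_and, not_lt] at h
    refine (h fun j hj => ?_).trans_eq ?_
    · refine (hgood ⟨j, hj⟩ y j (by omega)).trans_eq ?_
      congr 2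
      ext k
      simp [N, hj, SimpleGraph.adj_comm]
    · congr 1
      symm
      refine card_bij (fun i _ => Fin.castLE hmn i) ?_ ?_ ?_
      · intro i hi
        simpa [N] using hi
      · intro i _ i' _ h
        simpa using h
      · intro j hj
        simp only [mem_filter, mem_univ, true_and, N] at hj
        obtain ⟨hjm, hj⟩ := hj
        refine ⟨⟨j, hjm⟩, ?_, rfl⟩
        simpa [hjm] using hj
end

/-! ### Hall's theorem and the rainbow matching. -/

section
open scoped Classical
open Finset Equiv

lemma hasRainbowPerfectMatching_of_bijective {V ι : Type*} {H : ι → SimpleGraph V}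
    {g : ι ⊕ ι → V} (hg : g.Bijective) (hH : ∀ i, (H i).Adj (g (.inl i)) (g (.inr i))) :
    HasRainbowPerfectMatching H := by
  let M : (⊤ : SimpleGraph V).Subgraph :=
    { verts := Set.univ
      Adj := fun u v => ∃ i, s(g (.inl i), g (.inr i)) = s(u, v)
      adj_sub := by
        rintro u v ⟨i, hi⟩
        rw [← SimpleGraph.mem_edgeSet, ← hi]
        simpa using (hH i).ne
      edge_vert := fun _ => Set.mem_univ _
      symm := ⟨by
        rintro u v ⟨i, hi⟩
        exact ⟨i, hi.trans Sym2.eq_swap⟩⟩ }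
  refine ⟨M, ⟨fun v _ => ?_, fun v => Set.mem_univ v⟩, ?_⟩
  · obtain ⟨i | i, rfl⟩ := hg.2 v
    · refine ⟨g (.inr i), ⟨i, rfl⟩, ?_⟩
      rintro w ⟨j, hj⟩
      rcases Sym2.eq_iff.1 hj with ⟨h1, h2⟩ | ⟨h1, h2⟩
      · cases hg.1 h1; exact h2.symm
      · cases hg.1 h2
    · refine ⟨g (.inl i), ⟨i, Sym2.eq_swap⟩, ?_⟩
      rintro w ⟨j, hj⟩
      rcases Sym2.eq_iff.1 hj with ⟨h1, h2⟩ | ⟨h1, h2⟩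
      · cases hg.1 h1
      · cases hg.1 h2; exact h1.symm
  · let φ : ι → M.edgeSet := fun i => ⟨s(g (.inl i), g (.inr i)), ⟨i, rfl⟩⟩
    have hφ : φ.Bijective := by
      constructor
      · intro i j hij
        rcases Sym2.eq_iff.1 (Subtype.ext_iff.1 hij) with ⟨h1, h2⟩ | ⟨h1, h2⟩
        · cases hg.1 h1; rfl
        · cases hg.1 h1
      · rintro ⟨e, he⟩
        induction e with | _ u v => ?_
        obtain ⟨i, hi⟩ := he
        exact ⟨i, Subtype.ext hi⟩
    exact ⟨Equiv.ofBijective φ hφ, fun i => hH i⟩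

/-- Passes from the chosen subgraphs back to the random graphs, where sparsity is known. -/
lemma sum_card_adj_le_edgeCount {V W ι : Type*} [Fintype ι] [DecidableEq ι] [DecidableEq V]
    {G H : ι → SimpleGraph V} (hHG : ∀ i, H i ≤ G i) (x : ι → V) {y : W → V} (hy : y.Injective)
    (S : Finset ι) (Z : Finset W) :
    ∑ i ∈ S, #{k ∈ Z | (H i).Adj (x i) (y k)} ≤
      edgeCount G (fun i => if i ∈ S then some (x i) else none) (Z.image y) := by
  rw [edgeCount, ← sum_subset (subset_univ S)]
  · refine sum_le_sum fun i hi => ?_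
    simp only [if_pos hi, Option.elim_some]
    rw [← card_image_of_injective _ hy]
    refine card_le_card fun v hv => ?_
    obtain ⟨k, hk, rfl⟩ := mem_image.1 hv
    rw [mem_filter] at hk ⊢
    exact ⟨mem_image_of_mem _ hk.1, hHG i hk.2⟩
  · intro i _ hi
    simp [hi]

/-- Hall's theorem for the bipartite graph between the graphs `H i` and the last `m` positions
of a permutation: if all degrees are at least `D` and the graphs `G i` have no
denser spots, then there is a rainbow perfect matching. -/
lemma hasRainbowPerfectMatching_of_perm {n m : ℕ} (hn : n = 2 * m) (hmn : m ≤ n) (D : ℝ)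
    {G H : Fin m → SimpleGraph (Fin n)} (hHG : ∀ i, H i ≤ G i)
    (hG : ∀ (x : Fin m → Option (Fin n)) (T : Finset (Fin n)), 0 < max #{i | (x i).isSome} #T →
      2 * min #{i | (x i).isSome} #T ≤ m →
      (edgeCount G x T : ℝ) < D * (max #{i | (x i).isSome} #T : ℕ))
    (π : Perm (Fin n))
    (h₁ : ∀ i : Fin m,
      D ≤ #{k : Fin n | m ≤ (k : ℕ) ∧ (H i).Adj (π (Fin.castLE hmn i)) (π k)})
    (h₂ : ∀ y : Fin n, D ≤ #{i : Fin m | (H i).Adj (π (Fin.castLE hmn i)) y}) :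
    HasRainbowPerfectMatching H := by
  let t : Fin m → Finset (Fin n) := fun i =>
    {k | m ≤ (k : ℕ) ∧ (H i).Adj (π (Fin.castLE hmn i)) (π k)}
  have hsupp : ∀ S : Finset (Fin m), #{i | (if i ∈ S then some (π (Fin.castLE hmn i))
      else none : Option (Fin n)).isSome} = #S := by
    intro S
    congr 1
    ext i
    by_cases hi : i ∈ S <;> simp [hi]
  have hHall : ∀ S : Finset (Fin m), #S ≤ #(S.biUnion t) := by
    intro S
    by_contra! hlt
    have hSm : #S ≤ m := by simpa using card_le_univ S
    -- If the neighbourhood of `S` is small, all edges leaving `S` crowd into it: at least `D * #S`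
    -- of them.
    by_cases hcase : 2 * #(S.biUnion t) ≤ m
    · have h := hG (fun i => if i ∈ S then some (π (Fin.castLE hmn i)) else none)
        ((S.biUnion t).image π)
      rw [hsupp, card_image_of_injective _ π.injective, max_eq_left hlt.le,
        min_eq_right hlt.le] at h
      refine (h (by omega) hcase).not_ge ?_
      refine le_trans ?_ (Nat.cast_le.2
        (sum_card_adj_le_edgeCount hHG (fun i => π (Fin.castLE hmn i)) π.injective S _))
      rw [mul_comm, ← nsmul_eq_mul, ← sum_const, Nat.cast_sum]
      refine sum_le_sum fun i hi => (h₁ i).trans ?_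
      rw [Nat.cast_le]
      refine card_le_card fun k hk => ?_
      rw [mem_filter]
      exact ⟨mem_biUnion.2 ⟨i, hi, hk⟩, (mem_filter.1 hk).2.2⟩
    -- Otherwise pass to complements: positions outside the neighbourhood of `S` see only `Sᶜ`,
    -- which is smaller than their number and than `m/2`.
    · set Y : Finset (Fin n) := {k | m ≤ (k : ℕ)} with hY
      have hYcard : #Y = m := by
        have h1 := card_filter_add_card_filter_not (s := (univ : Finset (Fin n)))
          (fun k : Fin n => (k : ℕ) < m)
        simp only [not_lt, Fin.card_filter_val_lt, card_univ, Fintype.card_fin] at h1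
        rw [← hY] at h1
        omega
      have hsub : S.biUnion t ⊆ Y := by
        intro k hk
        obtain ⟨i, _, hk⟩ := mem_biUnion.1 hk
        exact mem_filter.2 ⟨mem_univ _, (mem_filter.1 hk).2.1⟩
      have hZ : #(Y \ S.biUnion t) = m - #(S.biUnion t) := by
        rw [card_sdiff_of_subset hsub, hYcard]
      have hSc : #Sᶜ = m - #S := by simp [card_compl]
      have hlt' : #Sᶜ < #(Y \ S.biUnion t) := by omega
      have h := hG (fun i => if i ∈ Sᶜ then some (π (Fin.castLE hmn i)) else none)
        ((Y \ S.biUnion t).image π)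
      rw [hsupp, card_image_of_injective _ π.injective, max_eq_right hlt'.le,
        min_eq_left hlt'.le] at h
      refine (h (by omega) (by omega)).not_ge ?_
      refine le_trans ?_ (Nat.cast_le.2
        (sum_card_adj_le_edgeCount hHG (fun i => π (Fin.castLE hmn i)) π.injective Sᶜ _))
      rw [mul_comm, ← nsmul_eq_mul, ← sum_const]
      simp_rw [card_filter]
      rw [sum_comm, Nat.cast_sum]
      refine sum_le_sum fun k hk => (h₂ (π k)).trans ?_
      rw [← card_filter, Nat.cast_le]
      refine card_le_card fun i hi => ?_
      rw [mem_filter, mem_compl]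
      rw [mem_filter] at hi
      rw [Finset.mem_sdiff, mem_filter] at hk
      exact ⟨fun hiS => hk.2 (mem_biUnion.2 ⟨i, hiS, mem_filter.2 ⟨mem_univ _, hk.1.2, hi.2⟩⟩),
        hi.2⟩
  obtain ⟨f, hfinj, hf⟩ := (all_card_le_biUnion_card_iff_exists_injective t).1 hHall
  have hf' : ∀ i, m ≤ (f i : ℕ) ∧ (H i).Adj (π (Fin.castLE hmn i)) (π (f i)) :=
    fun i => (mem_filter.1 (hf i)).2
  refine hasRainbowPerfectMatching_of_bijective
    (g := fun s => π (s.elim (Fin.castLE hmn) f)) ?_ fun i => (hf' i).2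
  rw [Fintype.bijective_iff_injective_and_card]
  refine ⟨π.injective.comp ?_, by simp; omega⟩
  refine (Fin.castLE_injective hmn).sumElim hfinj fun i j h => ?_
  have := (hf' j).1
  rw [← h] at this
  simp at this
  omega

lemma mem_rainbowMatchingResilient {ε p : ℝ} (hε : 0 < ε) (hε1 : ε ≤ 1) (hp0 : 0 ≤ p) {n m : ℕ}
    (hn : n = 2 * m) (hm : 0 < m) (hp : 6 * Real.log n ≤ ε ^ 2 / 1024 * (p * n))
    {d : ℝ} (hd : (1 / 2 + ε) * n * p ≤ d) {G : Fin m → SimpleGraph (Fin n)}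
    (hG : ∀ (x : Fin m → Option (Fin n)) (T : Finset (Fin n)), 0 < max #{i | (x i).isSome} #T →
      2 * min #{i | (x i).isSome} #T ≤ m →
      (edgeCount G x T : ℝ) < (1 / 2 + ε / 2) * m * p * (max #{i | (x i).isSome} #T : ℕ)) :
    G ∈ rainbowMatchingResilient (Fin n) (Fin m) d := by
  intro H hHG hH
  have hmn : m ≤ n := by omega
  obtain ⟨π, h₁, h₂⟩ := exists_perm_card_adj hε hε1 hp0 hn hm hmn hp H fun i v => by
    refine (hd.trans (hH i)).trans ?_
    rw [Nat.cast_le]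
    refine ((H i).minDegree_le_degree v).trans_eq ?_
    rw [← SimpleGraph.card_neighborFinset_eq_degree, SimpleGraph.neighborFinset_eq_filter]
  exact hasRainbowPerfectMatching_of_perm hn hmn _ hHG hG π h₁ h₂

lemma sub_le_measureReal_rainbowMatchingResilient {ε : ℝ} (hε : 0 < ε) (hε1 : ε ≤ 1)
    (p : unitInterval) {n m : ℕ} (hn : n = 2 * m) (hm : 0 < m)
    (hp : 6 * Real.log n ≤ ε ^ 2 / 1024 * (p * n)) {d : ℝ} (hd : (1 / 2 + ε) * n * p ≤ d) :
    2 - Real.exp (1 / m) ≤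
      (Measure.pi fun _ : Fin m => SimpleGraph.binomialRandom (Fin n) p).real
        (rainbowMatchingResilient (Fin n) (Fin m) d) := by
  have := measurableSingletonClass_simpleGraph (V := Fin n)
  have h := measureReal_exists_threshold_le_edgeCount (V := Fin n) (ι := Fin m) hε hε1 p m
    (by simpa using hn) (by simp) hm (by rwa [← hn])
  set B := {G : Fin m → SimpleGraph (Fin n) | ∃ (x : Fin m → Option (Fin n)) (T : Finset (Fin n)),
    0 < max #{i | (x i).isSome} #T ∧ 2 * min #{i | (x i).isSome} #T ≤ m ∧
    (1 / 2 + ε / 2) * m * p * (max #{i | (x i).isSome} #T : ℕ) ≤ edgeCount G x T} with hB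
  have hsub : Bᶜ ⊆ rainbowMatchingResilient (Fin n) (Fin m) d := by
    intro G hG
    refine mem_rainbowMatchingResilient hε hε1 p.2.1 hn hm hp hd fun x T h0 h1 => ?_
    by_contra! h2
    exact hG ⟨x, T, h0, h1, h2⟩
  refine le_trans ?_ (measureReal_mono hsub)
  rw [probReal_compl_eq_one_sub B.toFinite.measurableSet]
  linarith
end

/-! ### The limit along even `n`. -/

theorem theorem1 (ε : ℝ) (hε : 0 < ε) (p : ℕ → unitInterval)
    (hp : (fun n : ℕ => Real.log n / n) =o[atTop ⊓ 𝓟 {n : ℕ | Even n}] fun n => (p n : ℝ)) :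
    Tendsto
      (fun n : ℕ =>
        Measure.pi (fun _ : Fin (n / 2) => SimpleGraph.binomialRandom (Fin n) (p n))
          (rainbowMatchingResilient (Fin n) (Fin (n / 2)) ((1 / 2 + ε) * n * (p n : ℝ))))
      (atTop ⊓ 𝓟 {n : ℕ | Even n}) (𝓝 1) := by
  -- The exponential estimates need `ε ≤ 1`; lowering `ε` only weakens the degree assumption.
  have hε' : 0 < min ε 1 := lt_min hε one_pos
  have hreal : Tendsto
      (fun n : ℕ =>
        (Measure.pi (fun _ : Fin (n / 2) => SimpleGraph.binomialRandom (Fin n) (p n))).real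
          (rainbowMatchingResilient (Fin n) (Fin (n / 2)) ((1 / 2 + ε) * n * (p n : ℝ))))
      (atTop ⊓ 𝓟 {n : ℕ | Even n}) (𝓝 1) := by
    have hlim : Tendsto (fun n : ℕ => 2 - Real.exp (1 / (n / 2 : ℕ)))
        (atTop ⊓ 𝓟 {n : ℕ | Even n}) (𝓝 1) := by
      have h1 : Tendsto (fun n : ℕ => n / 2) atTop atTop :=
        Nat.tendsto_div_const_atTop two_ne_zero
      have h2 := (Real.continuous_exp.tendsto 0).comp (tendsto_one_div_atTop_nhds_zero_nat.comp h1)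
      have h3 := (h2.const_sub 2).mono_left
        (inf_le_left : atTop ⊓ 𝓟 {n : ℕ | Even n} ≤ atTop)
      rw [Real.exp_zero, show (2 : ℝ) - 1 = 1 by norm_num] at h3
      exact h3
    refine tendsto_of_tendsto_of_tendsto_of_le_of_le' hlim tendsto_const_nhds ?_
      (.of_forall fun n => measureReal_le_one)
    have heven : ∀ᶠ n : ℕ in atTop ⊓ 𝓟 {n : ℕ | Even n}, Even n :=
      mem_inf_of_right (mem_principal_self _)
    have hlarge : ∀ᶠ n : ℕ in atTop ⊓ 𝓟 {n : ℕ | Even n}, 2 ≤ n :=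
      mem_inf_of_left (eventually_ge_atTop 2)
    -- `6144 = 6 * 1024`, matching the hypothesis on `p` in the finite bound.
    filter_upwards [heven, hlarge, hp.def (show 0 < (min ε 1) ^ 2 / 6144 by positivity)]
      with n he hn hpn
    have hp0 : (0 : ℝ) ≤ p n := (p n).2.1
    have hn0 : (0 : ℝ) < n := by exact_mod_cast (by omega : 0 < n)
    refine sub_le_measureReal_rainbowMatchingResilient hε' (min_le_right _ _) (p n)
      (Nat.two_mul_div_two_of_even he).symm (by omega) ?_ ?_
    · rw [Real.norm_of_nonneg (div_nonneg (Real.log_natCast_nonneg n) hn0.le),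
        Real.norm_of_nonneg hp0, div_le_iff₀ hn0] at hpn
      linarith
    · gcongr
      exact min_le_left _ _
  have h := ENNReal.tendsto_ofReal hreal
  simpa [measureReal_def] using h
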